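/- All graphs are simple, finite and undirected. A walk in $G$ is a sequence $v_1,\dots,v_n$ of vertices with $v_iv_{i+1}\in E(G)$ for $1\le i<n$; it is a path if its vertices are pairwise distinct. A walk $v_1,\dots,v_{2t}$ with $t\ge1$ is repetitively coloured by a vertex colouring $f$ if $f(v_i)=f(v_{t+i})$ for all $i\in\{1,\dots,t\}$, and is boring if $v_i=v_{t+i}$ for all $i\in\{1,\dots,t\}$. Let $\pi(G)$ be the minimum $m$ such that $G$ has a vertex colouring with $m$ colours for which no path is repetitively coloured, and let $\sigma(G)$ be the minimum $m$ such that $G$ has a vertex colouring with $m$ colours for which every repetitively coloured walk is boring. The treewidth of $G$ is the minimum integer $k$ such that $G$ is a subgraph of a chordal graph with no clique on $k+2$ vertices (a graph is chordal if every cycle on at least four vertices has a chord). **Theorem.** Every graph $G$ with treewidth $k$ and maximum degree $\Delta\ge1$ satisfies $$\pi(G)\le 10(k+1)\left(\tfrac72\Delta-1\right)\quad\text{and}\quad\sigma(G)\le 10(k+1)\left(\tfrac72\Delta-1\right)(\Delta^2+1).$$ Moreover, there is an absolute constant $c$ such that every graph $G$ with treewidth $k$ and maximum degree $\Delta\ge1$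 satisfies $$\pi(G)\le c\,k\,\Delta\quad\text{and}\quad\sigma(G)\le c\,k\,\Delta^3.$$ -/

import Mathlib

namespace NonRep

universe u v

variable {V : Type u} {C : Type v}

/-- A finite sequence `w 0, w 1, …, w (n - 1)` of vertices is a walk in `G` if consecutive vertices
are adjacent. Only the first `n` values of `w` matter. -/
def IsWalkSeq (G : SimpleGraph V) (n : ℕ) (w : ℕ → V) : Prop :=
  ∀ i, i + 1 < n → G.Adj (w i) (w (i + 1))

/-- A path is a walk whose vertices are pairwise distinct. -/
def IsPathSeq (G : SimpleGraph V) (n : ℕ) (w : ℕ → V) : Prop :=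
  IsWalkSeq G n w ∧ ∀ i j, i < n → j < n → w i = w j → i = j

/-- The sequence `w 0, …, w (2 * t - 1)` is repetitively coloured by `f`. -/
def IsRepetitive (f : V → C) (t : ℕ) (w : ℕ → V) : Prop :=
  ∀ i, i < t → f (w i) = f (w (t + i))

/-- The sequence `w 0, …, w (2 * t - 1)` is boring. -/
def IsBoring (t : ℕ) (w : ℕ → V) : Prop :=
  ∀ i, i < t → w i = w (t + i)

/-- The colouring `f` is nonrepetitive on paths: no (nonempty) path is repetitively coloured. -/
def PathNonrepetitive (G : SimpleGraph V) (f : V → C) : Prop :=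
  ∀ (t : ℕ) (w : ℕ → V), 1 ≤ t → IsPathSeq G (2 * t) w → ¬ IsRepetitive f t w

/-- The colouring `f` is nonrepetitive on walks: every repetitively coloured walk is boring. -/
def WalkNonrepetitive (G : SimpleGraph V) (f : V → C) : Prop :=
  ∀ (t : ℕ) (w : ℕ → V), IsWalkSeq G (2 * t) w → IsRepetitive f t w → IsBoring t w

/-- `π(G)`: the minimum number of colours in a path-nonrepetitive colouring of `G`. -/
noncomputable def pathNumber (G : SimpleGraph V) : ℕ :=
  sInf {k : ℕ | ∃ f : V → Fin k, PathNonrepetitive G f}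

/-- `σ(G)`: the minimum number of colours in a walk-nonrepetitive colouring of `G`. -/
noncomputable def walkNumber (G : SimpleGraph V) : ℕ :=
  sInf {k : ℕ | ∃ f : V → Fin k, WalkNonrepetitive G f}

/-- A graph is chordal if every cycle on at least four vertices has a chord, that is, an edge
of the graph joining two vertices of the cycle that is not an edge of the cycle. -/
def IsChordal (H : SimpleGraph V) : Prop :=
  ∀ (a : V) (c : H.Walk a a), c.IsCycle → 4 ≤ c.length →
    ∃ x ∈ c.support, ∃ y ∈ c.support, H.Adj x y ∧ s(x, y) ∉ c.edges

/-- The treewidth of `G`: the minimum `k` such that `G` is a subgraph of a chordal graph with no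
clique on `k + 2` vertices. (The chordal graph may be taken on the vertex set of `G`, since induced
subgraphs of chordal graphs are chordal.) -/
noncomputable def treewidth (G : SimpleGraph V) : ℕ :=
  sInf {k : ℕ | ∃ H : SimpleGraph V, G ≤ H ∧ IsChordal H ∧ H.CliqueFree (k + 2)}

/-! The three minima are attained on finite graphs. -/

theorem WalkNonrepetitive.pathNonrepetitive {G : SimpleGraph V} {f : V → C}
    (h : WalkNonrepetitive G f) : PathNonrepetitive G f := by
  intro t w ht hp hr
  have := hp.2 0 (t + 0) (by omega) (by omega) (h t w hp.1 hr 0 (by omega))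
  omega

theorem exists_walkNonrepetitive [Finite V] (G : SimpleGraph V) :
    ∃ f : V → Fin (walkNumber G), WalkNonrepetitive G f := by
  refine Nat.sInf_mem (s := {k : ℕ | ∃ f : V → Fin k, WalkNonrepetitive G f}) ?_
  exact ⟨Nat.card V, Finite.equivFin V, fun t w _ hr i hi => (Finite.equivFin V).injective (hr i hi)⟩

theorem exists_pathNonrepetitive [Finite V] (G : SimpleGraph V) :
    ∃ f : V → Fin (pathNumber G), PathNonrepetitive G f := by
  refine Nat.sInf_mem (s := {k : ℕ | ∃ f : V → Fin k, PathNonrepetitive G f}) ?_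
  obtain ⟨f, hf⟩ := exists_walkNonrepetitive G
  exact ⟨_, f, hf.pathNonrepetitive⟩

theorem isChordal_top : IsChordal (⊤ : SimpleGraph V) := by
  intro a c hc hl
  have inj : ∀ i j, 1 ≤ i → i ≤ c.length → 1 ≤ j → j ≤ c.length →
      c.getVert i = c.getVert j → i = j := fun i j h1 h2 h3 h4 h =>
    hc.getVert_injOn (Set.mem_ofPred.2 ⟨h1, h2⟩) (Set.mem_ofPred.2 ⟨h3, h4⟩) h
  refine ⟨c.getVert 1, c.getVert_mem_support 1, c.getVert 3, c.getVert_mem_support 3, ?_, ?_⟩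
  · rw [SimpleGraph.top_adj]
    intro h
    have := inj 1 3 (by omega) (by omega) (by omega) (by omega) h
    omega
  · intro h
    obtain ⟨i, hi, he⟩ : ∃ i < c.length, s(c.getVert i, c.getVert (i + 1)) =
        s(c.getVert 1, c.getVert 3) :=
      (c.mk_mem_edges_iff_exists).1 h
    have h0 : c.getVert 0 = c.getVert c.length := by simp
    rcases Nat.eq_zero_or_pos i with rfl | hp
    · rw [h0, Sym2.eq_iff] at he
      rcases he with ⟨h1, h2⟩ | ⟨h1, h2⟩
      · have := inj _ _ (by omega) (by omega) (by omega) (by omega) h1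
        omega
      · have := inj _ _ (by omega) (by omega) (by omega) (by omega) h1
        omega
    · rw [Sym2.eq_iff] at he
      rcases he with ⟨h1, h2⟩ | ⟨h1, h2⟩ <;>
      · have := inj _ _ (by omega) (by omega) (by omega) (by omega) h1
        have := inj _ _ (by omega) (by omega) (by omega) (by omega) h2
        omega

theorem treewidth_spec [Finite V] (G : SimpleGraph V) :
    ∃ H : SimpleGraph V, G ≤ H ∧ IsChordal H ∧ H.CliqueFree (treewidth G + 2) := by
  refine Nat.sInf_mem
    (s := {k : ℕ | ∃ H : SimpleGraph V, G ≤ H ∧ IsChordal H ∧ H.CliqueFree (k + 2)}) ?_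
  have := Fintype.ofFinite V
  exact ⟨Fintype.card V, ⊤, le_top, isChordal_top, SimpleGraph.cliqueFree_of_card_lt (by omega)⟩

end NonRep

/-! Put n = k + 1. The colouring comes from a layering: a depth function changing by at most one
along each edge, whose bags (the vertices of one depth i lying in one component of the part of depth
at least i) have at most 8nΔ - 3n vertices. Colour v by a letter of a four-letter word at its depth
together with a label injective on each bag. The word forces a repetitively coloured lazy walk on ℕ
to be boring, so the two halves of a repetitive walk have equal depths. Where the first half is
shallowest, the matching vertices of the two halves share a bag and a label, hence coincide. So
paths are never repetitive; a further colouring of pairs at distance two with Δ² + 1 colours spreads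
the coincidence over the whole walk. The layering is built recursively from a root set S. If S is
small it is a layer, and its neighbours are the next root set; if it is large, a balanced separator
of size n splits the problem. Such separators exist because a chordal graph has balanced clique
separators. The count 4(8nΔ - 3n) is at most 10n(7Δ/2 - 1). -/

namespace NonRep

universe u v

variable {V : Type u} {C : Type v}

/-! ### Square-free words -/

/-- The Thue–Morse sequence. -/
def thueMorse (n : ℕ) : Bool :=
  if n = 0 then false else xor (decide (n % 2 = 1)) (thueMorse (n / 2))
termination_by n
decreasing_by omega

theorem thueMorse_two_mul (n : ℕ) : thueMorse (2 * n) = thueMorse n := by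
  rcases Nat.eq_zero_or_pos n with rfl | h
  · rfl
  · rw [thueMorse, if_neg (by omega)]
    simp

theorem thueMorse_two_mul_add_one (n : ℕ) : thueMorse (2 * n + 1) = !thueMorse n := by
  rw [thueMorse, if_neg (by omega), show (2 * n + 1) / 2 = n by omega,
    show (2 * n + 1) % 2 = 1 by omega]
  simp

theorem thueMorse_ne_succ {n : ℕ} (h : n % 2 = 0) : thueMorse (n + 1) = !thueMorse n := by
  obtain ⟨m, rfl⟩ : ∃ m, n = 2 * m := ⟨n / 2, by omega⟩
  rw [thueMorse_two_mul, thueMorse_two_mul_add_one]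

/-- The Thue–Morse sequence contains no overlap. -/
theorem thueMorse_overlapFree (p : ℕ) : 1 ≤ p → ∀ i,
    ¬ ∀ j ≤ p, thueMorse (i + j) = thueMorse (i + j + p) := by
  induction p using Nat.strong_induction_on with
  | _ p ih =>
  intro hp i h
  -- An even period keeps parity, so every second letter of the overlap gives one of half the
  -- period.
  rcases Nat.even_or_odd' p with ⟨q, rfl | hq⟩
  · refine ih q (by omega) (by omega) (i / 2) fun j hj => ?_
    have := h (2 * j) (by omega)
    rcases Nat.even_or_odd' i with ⟨m, rfl | rfl⟩
    · rw [show 2 * m + 2 * j = 2 * (m + j) by ring,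
        show 2 * (m + j) + 2 * q = 2 * (m + j + q) by ring, thueMorse_two_mul,
        thueMorse_two_mul] at this
      rwa [show 2 * m / 2 = m by omega]
    · rw [show 2 * m + 1 + 2 * j = 2 * (m + j) + 1 by ring,
        show 2 * (m + j) + 1 + 2 * q = 2 * (m + j + q) + 1 by ring, thueMorse_two_mul_add_one,
        thueMorse_two_mul_add_one] at this
      rw [show (2 * m + 1) / 2 = m by omega]
      simpa using this
  -- For odd `p`, one of `i + j`, `i + j + p` is even, where consecutive letters differ. The letters
  -- thus alternate over the window, and its ends, an odd distance apart, cannot agree.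
  · have alt : ∀ j < p, thueMorse (i + j + 1) = !thueMorse (i + j) := by
      intro j hj
      rcases Nat.mod_two_eq_zero_or_one (i + j) with h0 | h0
      · exact thueMorse_ne_succ h0
      · have h1 := thueMorse_ne_succ (n := i + j + p) (by omega)
        have h2 := h j (by omega)
        have h3 := h (j + 1) (by omega)
        rw [show i + (j + 1) = i + j + 1 by ring, show i + j + 1 + p = i + j + p + 1 by ring] at h3
        rw [h3, h1, h2]
    have key : ∀ j ≤ p, thueMorse (i + j) = xor (decide (j % 2 = 1)) (thueMorse i) := by
      intro j
      induction j with
      | zero => simp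
      | succ j ihj =>
        intro hj
        rw [← add_assoc, alt j (by omega), ihj (by omega)]
        rcases Nat.mod_two_eq_zero_or_one j with h0 | h0
        · simp [h0, show (j + 1) % 2 = 1 by omega]
        · simp [h0, show (j + 1) % 2 = 0 by omega]
    have h1 := key p le_rfl
    have h2 := h 0 (by omega)
    rw [add_zero] at h2
    rw [← h2, show p % 2 = 1 by omega] at h1
    simp at h1

/-- A square-free sequence on three letters: the differences of the Thue–Morse sequence. -/
def ternaryWord (n : ℕ) : Fin 4 :=
  if thueMorse n = thueMorse (n + 1) then 0 else if thueMorse n then 1 else 2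

/-- Letters encode differences of consecutive Thue–Morse bits, so a square makes the shift by `p`
change the bits by a constant. Applied twice, the shift changes a bit by at most one, so the
constant is zero and an overlap appears. -/
theorem ternaryWord_squareFree {p : ℕ} (hp : 1 ≤ p) (i : ℕ) :
    ¬ ∀ j < p, ternaryWord (i + j) = ternaryWord (i + j + p) := by
  intro h
  have step : ∀ j < p, (thueMorse (i + j + 1)).toInt - (thueMorse (i + j)).toInt =
      (thueMorse (i + j + p + 1)).toInt - (thueMorse (i + j + p)).toInt := by
    intro j hj
    have := h j hj
    unfold ternaryWord at this
    revert this
    cases thueMorse (i + j) <;> cases thueMorse (i + j + 1) <;> cases thueMorse (i + j + p) <;>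
      cases thueMorse (i + j + p + 1) <;> simp
  have diff : ∀ j ≤ p, (thueMorse (i + j + p)).toInt - (thueMorse (i + j)).toInt =
      (thueMorse (i + p)).toInt - (thueMorse i).toInt := by
    intro j
    induction j with
    | zero => simp
    | succ j ihj =>
      intro hj
      have h1 := step j (by omega)
      have h2 := ihj (by omega)
      rw [← add_assoc, show i + j + 1 + p = i + j + p + 1 by ring]
      omega
  have zero : (thueMorse (i + p)).toInt - (thueMorse i).toInt = 0 := by
    have := diff p le_rfl
    revert this
    cases thueMorse i <;> cases thueMorse (i + p) <;> cases thueMorse (i + p + p) <;> simp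
  refine thueMorse_overlapFree p hp i fun j hj => ?_
  have := diff j hj
  rw [zero] at this
  revert this
  cases thueMorse (i + j) <;> cases thueMorse (i + j + p) <;> simp

theorem ternaryWord_ne_three (n : ℕ) : ternaryWord n ≠ 3 := by
  unfold ternaryWord
  split_ifs <;> decide

/-- A square-free sequence on four letters in which any three consecutive letters are distinct,
obtained by inserting the letter `3` after every second letter of `ternaryWord`. -/
def levelWord (n : ℕ) : Fin 4 :=
  if n % 3 = 2 then 3 else ternaryWord (2 * (n / 3) + n % 3)

theorem levelWord_eq_three_iff {n : ℕ} : levelWord n = 3 ↔ n % 3 = 2 := by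
  unfold levelWord
  split_ifs with h
  · simp [h]
  · simp [h, ternaryWord_ne_three]

theorem ternaryWord_ne_succ (n : ℕ) : ternaryWord n ≠ ternaryWord (n + 1) := fun h =>
  ternaryWord_squareFree le_rfl n fun j hj => by
    obtain rfl : j = 0 := by omega
    exact h

theorem levelWord_ne_succ (n : ℕ) : levelWord n ≠ levelWord (n + 1) := by
  intro h
  have h3 : n % 3 = 2 ↔ (n + 1) % 3 = 2 := by
    rw [← levelWord_eq_three_iff, h, levelWord_eq_three_iff]
  have hn : n % 3 = 0 := by omega
  rw [levelWord, levelWord, if_neg (by omega), if_neg (by omega)] at h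
  refine ternaryWord_ne_succ (2 * (n / 3) + n % 3) ?_
  rw [h]
  congr 1
  omega

theorem levelWord_ne_add_two (n : ℕ) : levelWord n ≠ levelWord (n + 2) := by
  intro h
  have h3 : n % 3 = 2 ↔ (n + 2) % 3 = 2 := by
    rw [← levelWord_eq_three_iff, h, levelWord_eq_three_iff]
  have hn : n % 3 = 1 := by omega
  rw [levelWord, levelWord, if_neg (by omega), if_neg (by omega)] at h
  refine ternaryWord_ne_succ (2 * (n / 3) + n % 3) ?_
  rw [h]
  congr 1
  omega

theorem levelWord_squareFree {p : ℕ} (hp : 1 ≤ p) (i : ℕ) :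
    ¬ ∀ j < p, levelWord (i + j) = levelWord (i + j + p) := by
  intro h
  have h3 : ∀ j < p, ((i + j) % 3 = 2 ↔ (i + j + p) % 3 = 2) := fun j hj => by
    rw [← levelWord_eq_three_iff, h j hj, levelWord_eq_three_iff]
  have hp1 : p ≠ 1 := by
    rintro rfl
    exact levelWord_ne_succ i (h 0 (by omega))
  have hp2 : p ≠ 2 := by
    rintro rfl
    exact levelWord_ne_add_two i (h 0 (by omega))
  -- Here `p ≥ 3`, so the window contains a letter 3, and its shift by `p` is again a 3.
  have hmod : p % 3 = 0 := by
    have h0 := h3 0 (by omega)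
    have h1 := h3 1 (by omega)
    have h2 := h3 2 (by omega)
    omega
  refine ternaryWord_squareFree (p := 2 * (p / 3)) (by omega)
    (2 * (i / 3) + i % 3) fun l hl => ?_
  -- Letter `e` of `ternaryWord` sits at position `3 * (e / 2) + e % 2` of `levelWord`; deleting the
  -- 3s turns the period `p` into `2 * (p / 3)`.
  set e := 2 * (i / 3) + i % 3 + l with he
  have hj := h (3 * (e / 2) + e % 2 - i) (by omega)
  have hei : i ≤ 3 * (e / 2) + e % 2 := by omega
  rw [show i + (3 * (e / 2) + e % 2 - i) = 3 * (e / 2) + e % 2 by omega, levelWord, levelWord,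
    if_neg (by omega), if_neg (by omega)] at hj
  rw [show 2 * ((3 * (e / 2) + e % 2) / 3) + (3 * (e / 2) + e % 2) % 3 = e by omega,
    show 2 * ((3 * (e / 2) + e % 2 + p) / 3) + (3 * (e / 2) + e % 2 + p) % 3 = e + 2 * (p / 3)
      by omega] at hj
  exact hj

theorem levelWord_eq_of_close {a b : ℕ} (h : levelWord a = levelWord b) (h1 : a ≤ b + 2)
    (h2 : b ≤ a + 2) : a = b := by
  by_contra hne
  obtain rfl | rfl | rfl | rfl : b = a + 1 ∨ b = a + 2 ∨ a = b + 1 ∨ a = b + 2 := by omega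
  · exact levelWord_ne_succ _ h
  · exact levelWord_ne_add_two _ h
  · exact levelWord_ne_succ _ h.symm
  · exact levelWord_ne_add_two _ h.symm

/-! ### Lazy walks on the natural numbers -/

/-- `(x, y)` and `(a, b)` carry equal letters, where `a` is next to `x`, `b` is next to `y` and
the step from `y` to `b` is `e` times the step from `x` to `a`. -/
def Oriented (e : ℤ) (x y : ℕ) : Prop :=
  ∃ a b : ℕ, levelWord a = levelWord b ∧ ((a : ℤ) - x = 1 ∨ (a : ℤ) - x = -1) ∧
    (b : ℤ) - y = e * ((a : ℤ) - x)

/-- Three consecutive letters are distinct, so once one neighbour of `x` is matched with one of `y`,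
the next letter tells apart staying, moving to the matched side and moving away. The direction `e`
can never change. -/
theorem Oriented.step {e : ℤ} (he : e = 1 ∨ e = -1) {x y x' y' : ℕ} (h : Oriented e x y)
    (hxy : levelWord x = levelWord y) (hxy' : levelWord x' = levelWord y')
    (hx : x ≤ x' + 1 ∧ x' ≤ x + 1) (hy : y ≤ y' + 1 ∧ y' ≤ y + 1) :
    (y' : ℤ) - y = e * ((x' : ℤ) - x) ∧ Oriented e x' y' := by
  obtain ⟨a, b, hab, ha, hb⟩ := h
  have e1 : x = x' → y = y' := by
    rintro rfl
    exact levelWord_eq_of_close (hxy.symm.trans hxy') (by omega) (by omega)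
  have e2 : y = y' → x = x' := by
    rintro rfl
    exact levelWord_eq_of_close (hxy.trans hxy'.symm) (by omega) (by omega)
  have hby : b ≤ y + 1 ∧ y ≤ b + 1 := by
    rcases he with rfl | rfl <;> omega
  have e3 : x' = a → y' = b := by
    rintro rfl
    exact levelWord_eq_of_close (hxy'.symm.trans hab) (by omega) (by omega)
  have e4 : y' = b → x' = a := by
    rintro rfl
    exact levelWord_eq_of_close (hxy'.trans hab.symm) (by omega) (by omega)
  have key : (y' : ℤ) - y = e * ((x' : ℤ) - x) := by
    rcases he with rfl | rfl <;> omega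
  refine ⟨key, ?_⟩
  by_cases hxx : x = x'
  · obtain rfl := hxx
    obtain rfl := e1 rfl
    exact ⟨a, b, hab, ha, hb⟩
  · refine ⟨x, y, hxy, by omega, ?_⟩
    linear_combination -key

/-- A lazy walk on the natural numbers that is repetitively coloured by `levelWord` is boring. -/
theorem levelWord_lazyWalk {t : ℕ} {x : ℕ → ℕ}
    (hx : ∀ i, i + 1 < 2 * t → x i ≤ x (i + 1) + 1 ∧ x (i + 1) ≤ x i + 1)
    (hs : ∀ i < t, levelWord (x i) = levelWord (x (t + i))) :
    ∀ i < t, x i = x (t + i) := by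
  by_contra! hne
  obtain ⟨i₀, hi₀, hne⟩ := hne
  have up : ∀ i, i + 1 < t → (x i = x (t + i) ↔ x (i + 1) = x (t + (i + 1))) := by
    intro i hi
    have h1 := hx i (by omega)
    have h2 := hx (t + i) (by omega)
    rw [add_assoc] at h2
    constructor <;> intro h
    · exact levelWord_eq_of_close (hs _ hi) (by omega) (by omega)
    · exact levelWord_eq_of_close (hs _ (by omega)) (by omega) (by omega)
  have to_zero : ∀ i < t, (x 0 = x (t + 0) ↔ x i = x (t + i)) := by
    intro i
    induction i with
    | zero => simp
    | succ i ih => exact fun hi => (ih (by omega)).trans (up i hi)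
  -- Equal letters within distance two mean equal positions, so disagreement at one index persists
  -- at all indices with a gap of at least three, too wide for the order of the halves to switch.
  have far : ∀ i < t, x i + 3 ≤ x (t + i) ∨ x (t + i) + 3 ≤ x i := by
    intro i hi
    by_contra! h
    exact hne (((to_zero i hi).symm.trans (to_zero i₀ hi₀)).1
      (levelWord_eq_of_close (hs i hi) (by omega) (by omega)))
  have sign : ∀ i < t, (x 0 ≤ x (t + 0) ↔ x i ≤ x (t + i)) := by
    intro i
    induction i with
    | zero => simp
    | succ i ih =>
      intro hi
      have h1 := hx i (by omega)
      have h2 := hx (t + i) (by omega)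
      have h3 := far i (by omega)
      have h4 := far (i + 1) (by omega)
      rw [add_assoc] at h2
      rw [ih (by omega)]
      omega
  have orient : ∀ i < t, ((∀ j ≤ i, x j = x 0 ∧ x (t + j) = x t)) ∨
      ∃ e : ℤ, (e = 1 ∨ e = -1) ∧ (∀ j ≤ i, (x (t + j) : ℤ) - x t = e * ((x j : ℤ) - x 0)) ∧
        Oriented e (x i) (x (t + i)) := by
    intro i
    induction i with
    | zero =>
      intro _
      left
      intro j hj
      obtain rfl : j = 0 := by omega
      simp
    | succ i ih =>
      intro hi
      have h1 := hx i (by omega)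
      have h2 := hx (t + i) (by omega)
      rw [add_assoc] at h2
      have s1 := hs i (by omega)
      have s2 := hs (i + 1) hi
      rcases ih (by omega) with h | ⟨e, he, h, ho⟩
      · have hi0 := h i le_rfl
        by_cases hxx : x (i + 1) = x i
        · have : x (t + (i + 1)) = x (t + i) :=
            levelWord_eq_of_close (by rw [← s2, hxx, s1]) (by omega) (by omega)
          left
          intro j hj
          rcases Nat.lt_or_ge i j with hj' | hj'
          · obtain rfl : j = i + 1 := by omega
            omega
          · exact h j hj'
        · have hyy : x (t + (i + 1)) ≠ x (t + i) := fun hyy =>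
            hxx (levelWord_eq_of_close (by rw [s2, hyy, s1]) (by omega) (by omega))
          obtain ⟨e, he, hstep⟩ : ∃ e : ℤ, (e = 1 ∨ e = -1) ∧
              (x (t + (i + 1)) : ℤ) - x (t + i) = e * ((x (i + 1) : ℤ) - x i) := by
            by_cases hsame : (x (t + (i + 1)) : ℤ) - x (t + i) = (x (i + 1) : ℤ) - x i
            · exact ⟨1, Or.inl rfl, by omega⟩
            · exact ⟨-1, Or.inr rfl, by omega⟩
          refine Or.inr ⟨e, he, fun j hj => ?_, x i, x (t + i), s1, by omega, by
            linear_combination -hstep⟩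
          rcases Nat.lt_or_ge i j with hj' | hj'
          · obtain rfl : j = i + 1 := by omega
            rw [← hi0.1, ← hi0.2, hstep]
          · rw [(h j hj').1, (h j hj').2]
            simp
      · obtain ⟨hstep, ho'⟩ := ho.step he s1 s2 h1 h2
        refine Or.inr ⟨e, he, fun j hj => ?_, ho'⟩
        rcases Nat.lt_or_ge i j with hj' | hj'
        · obtain rfl : j = i + 1 := by omega
          linear_combination hstep + h i le_rfl
        · exact h j hj'
  obtain ⟨e, he, hlin⟩ : ∃ e : ℤ, (e = 1 ∨ e = -1) ∧
      ∀ j < t, (x (t + j) : ℤ) - x t = e * ((x j : ℤ) - x 0) := by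
    rcases orient (t - 1) (by omega) with h | ⟨e, he, h, -⟩
    · refine ⟨1, Or.inl rfl, fun j hj => ?_⟩
      rw [(h j (by omega)).1, (h j (by omega)).2]
      simp
    · exact ⟨e, he, fun j hj => h j (by omega)⟩
  have hlast := hlin (t - 1) (by omega)
  have f0 := far 0 (by omega)
  have f1 := far (t - 1) (by omega)
  have sg := sign (t - 1) (by omega)
  have link := hx (t - 1) (by omega)
  rw [show t - 1 + 1 = t by omega] at link
  rw [add_zero] at f0 sg
  have ivt : ∀ j < t, ∀ a, x 0 ≤ a ∧ a ≤ x j ∨ x j ≤ a ∧ a ≤ x 0 → ∃ i < t, x i = a := by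
    intro j
    induction j with
    | zero => exact fun hj a ha => ⟨0, hj, by omega⟩
    | succ j ih =>
      intro hj a ha
      by_cases hja : x (j + 1) = a
      · exact ⟨j + 1, hj, hja⟩
      · have := hx j (by omega)
        exact ih (by omega) a (by omega)
  -- If `e = 1`, the second half is a translate of the first. As `x (t - 1)` is within one of `x t`,
  -- the first half visits a full period, and `levelWord` contains a square.
  rcases he with rfl | rfl
  · rcases f0 with f0 | f0
    · refine levelWord_squareFree (p := x t - x 0) (by omega) (x 0) fun j hj => ?_
      obtain ⟨i, hi, hxi⟩ := ivt (t - 1) (by omega) (x 0 + j) (by omega)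
      have := hlin i hi
      rw [← hxi, hs i hi]
      congr 1
      omega
    · refine levelWord_squareFree (p := x 0 - x t) (by omega) (x (t + (t - 1))) fun j hj => ?_
      obtain ⟨i, hi, hxi⟩ := ivt (t - 1) (by omega) (x (t - 1) + j) (by omega)
      have := hlin i hi
      rw [show x (t + (t - 1)) + j + (x 0 - x t) = x i by omega, hs i hi]
      congr 1
      omega
  -- A reflection keeps `x j + x (t + j)` constant; since `x (t - 1)` and `x t` are within one of
  -- each other, the halves would be ordered oppositely at indices 0 and `t - 1`, against `sg`.
  · omega

/-! ### From depth functions to colourings -/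

/-- The subgraph of the edges of `G` with both ends in `B`. -/
def within (G : SimpleGraph V) (B : Set V) : SimpleGraph V where
  Adj u v := G.Adj u v ∧ u ∈ B ∧ v ∈ B
  symm := ⟨fun _ _ h => ⟨h.1.symm, h.2.2, h.2.1⟩⟩
  loopless := ⟨fun _ h => G.loopless.irrefl _ h.1⟩

theorem within_mono {G H : SimpleGraph V} {B B' : Set V} (h : G ≤ H) (hB : B ⊆ B') :
    within G B ≤ within H B' := fun _ _ hu => ⟨h hu.1, hB hu.2.1, hB hu.2.2⟩

theorem IsWalkSeq.reachable {G : SimpleGraph V} {n : ℕ} {w : ℕ → V} (hw : IsWalkSeq G n w)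
    {B : Set V} (hB : ∀ i < n, w i ∈ B) {i j : ℕ} (hij : i ≤ j) (hj : j < n) :
    (within G B).Reachable (w i) (w j) := by
  induction j, hij using Nat.le_induction with
  | base => exact .refl _
  | succ j hij ih =>
    refine (ih (by omega)).trans (SimpleGraph.Adj.reachable ?_)
    exact ⟨hw j hj, hB _ (by omega), hB _ hj⟩

/-- No walk `w` of even length `2 * t` with `w i ≠ w (t + i)` for all `i < t` (a stroll) is
repetitively coloured. -/
def StrollNonrepetitive (G : SimpleGraph V) (f : V → C) : Prop :=
  ∀ (t : ℕ) (w : ℕ → V), 1 ≤ t → IsWalkSeq G (2 * t) w → IsRepetitive f t w →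
    ∃ i < t, w i = w (t + i)

theorem StrollNonrepetitive.pathNonrepetitive {G : SimpleGraph V} {f : V → C}
    (h : StrollNonrepetitive G f) : PathNonrepetitive G f := by
  intro t w ht hw hr
  obtain ⟨i, hi, h⟩ := h t w ht hw.1 hr
  have := hw.2 i (t + i) (by omega) (by omega) h
  omega

/-- Distinct vertices at distance at most two receive distinct colours. -/
def DistanceTwo (G : SimpleGraph V) (g : V → C) : Prop :=
  ∀ a b c, G.Adj a b → G.Adj a c → g b = g c → b = c

/-- The halves agree at some index. Agreement passes to adjacent indices, because the next vertices
are neighbours of one vertex with the same `g`-colour. -/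
theorem StrollNonrepetitive.walkNonrepetitive {D : Type*} {G : SimpleGraph V} {f : V → C}
    {g : V → D} (hf : StrollNonrepetitive G f) (hg : DistanceTwo G g) :
    WalkNonrepetitive G fun v => (f v, g v) := by
  intro t w hw hr
  have rf : IsRepetitive f t w := fun i hi => congrArg Prod.fst (hr i hi)
  have rg : IsRepetitive g t w := fun i hi => congrArg Prod.snd (hr i hi)
  rcases Nat.eq_zero_or_pos t with rfl | ht
  · intro i hi
    omega
  obtain ⟨i₀, hi₀, h₀⟩ := hf t w ht hw rf
  have up : ∀ i, i + 1 < t → (w i = w (t + i) ↔ w (i + 1) = w (t + (i + 1))) := by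
    intro i hi
    have h1 := hw i (by omega)
    have h2 := hw (t + i) (by omega)
    rw [add_assoc] at h2
    constructor <;> intro h
    · exact hg _ _ _ h1 (h ▸ h2) (rg _ hi)
    · exact hg _ _ _ h1.symm (h ▸ h2.symm) (rg _ (by omega))
  have to_zero : ∀ i < t, (w 0 = w (t + 0) ↔ w i = w (t + i)) := by
    intro i
    induction i with
    | zero => simp
    | succ i ih => exact fun hi => (ih (by omega)).trans (up i hi)
  exact fun i hi => ((to_zero i₀ hi₀).symm.trans (to_zero i hi)).1 h₀

/-- The bag of `v` for the depth function `d`: the vertices of `A` at the depth of `v` that are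
joined to `v` within the vertices of `A` of at least that depth. -/
def bag (G : SimpleGraph V) (A : Set V) (d : V → ℕ) (v : V) : Set V :=
  {u | u ∈ A ∧ d u = d v ∧ (within G {z | z ∈ A ∧ d v ≤ d z}).Reachable v u}

/-- At an index `j` minimizing depth in the first half, the whole walk stays at least that deep,
since both halves have the same depths. So `w j` and `w (t + j)` share a bag, where `idx` separates
vertices. -/
theorem strollNonrepetitive_of_depth {G : SimpleGraph V} {d : V → ℕ} {I : Type*} {idx : V → I}
    (hd : ∀ u v, G.Adj u v → d u ≤ d v + 1)
    (hidx : ∀ u v, u ∈ bag G Set.univ d v → idx u = idx v → u = v) :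
    StrollNonrepetitive G fun v => (levelWord (d v), idx v) := by
  intro t w ht hw hr
  have hlev := levelWord_lazyWalk (t := t) (x := fun i => d (w i))
    (fun i hi => ⟨hd _ _ (hw i hi), hd _ _ (hw i hi).symm⟩)
    (fun i hi => congrArg Prod.fst (hr i hi))
  obtain ⟨j, hj, hmin⟩ := Finset.exists_min_image (Finset.range t) (fun i => d (w i))
    ⟨0, Finset.mem_range.2 ht⟩
  simp only [Finset.mem_range] at hj hmin
  suffices hmem : w (t + j) ∈ bag G Set.univ d (w j) from
    ⟨j, hj, (hidx _ _ hmem (congrArg Prod.snd (hr j hj)).symm).symm⟩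
  refine ⟨trivial, (hlev j hj).symm, ?_⟩
  refine hw.reachable (B := {z | z ∈ Set.univ ∧ d (w j) ≤ d z}) (fun i hi => ⟨trivial, ?_⟩)
    (by omega) (by omega)
  rcases Nat.lt_or_ge i t with h | h
  · exact hmin i h
  · have h1 := hmin (i - t) (by omega)
    have h2 := hlev (i - t) (by omega)
    simp only [show t + (i - t) = i by omega] at h2
    omega

/-- An equivalence relation whose classes have at most `W` elements has an injective labelling of
each class by `W` labels. -/
theorem exists_index [Finite V] (r : Setoid V) (W : ℕ) (hW : ∀ v, {u | r v u}.ncard ≤ W) :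
    ∃ idx : V → Fin W, ∀ u v, r v u → idx u = idx v → u = v := by
  classical
  have emb : ∀ q : Quotient r, ∃ g : {u // Quotient.mk r u = q} → Fin W, Function.Injective g := by
    intro q
    have hq : Nat.card {u // Quotient.mk r u = q} ≤ W := by
      induction q using Quotient.inductionOn with
      | h v =>
        refine le_trans (le_of_eq ?_) (hW v)
        rw [← Nat.card_coe_set_eq]
        refine Nat.card_congr (Equiv.subtypeEquivRight fun u => ?_)
        rw [Quotient.eq]
        exact ⟨fun h => r.symm h, fun h => r.symm h⟩
    exact ⟨Fin.castLE hq ∘ Finite.equivFin _,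
      (Fin.castLE_injective hq).comp (Finite.equivFin _).injective⟩
  choose g hg using emb
  refine ⟨fun v => g (Quotient.mk r v) ⟨v, rfl⟩, fun u v h huv => ?_⟩
  have hq : Quotient.mk r u = Quotient.mk r v := Quotient.sound (r.symm h)
  have : ∀ q (hu : Quotient.mk r u = q) (hv : Quotient.mk r v = q),
      g q ⟨u, hu⟩ = g q ⟨v, hv⟩ → u = v := fun q hu hv h => congrArg Subtype.val (hg q h)
  refine this _ hq rfl ?_
  have lab : ∀ q (hu : Quotient.mk r u = q), g (Quotient.mk r u) ⟨u, rfl⟩ = g q ⟨u, hu⟩ := by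
    rintro _ rfl
    rfl
  rw [← lab _ hq]
  exact huv

/-- The vertices of a graph whose degrees are less than `m` can be properly coloured with `m`
colours. -/
theorem exists_coloring_of_ncard_lt [Finite V] (G : SimpleGraph V) (m : ℕ)
    (h : ∀ v, {u | G.Adj v u}.ncard < m) : ∃ g : V → Fin m, ∀ u v, G.Adj u v → g u ≠ g v := by
  classical
  have := Fintype.ofFinite V
  rcases isEmpty_or_nonempty V with hV | ⟨⟨v₀⟩⟩
  · exact ⟨fun v => isEmptyElim v, fun v => isEmptyElim v⟩
  suffices ∀ s : Finset V, ∃ g : V → Fin m, ∀ u ∈ s, ∀ v ∈ s, G.Adj u v → g u ≠ g v by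
    obtain ⟨g, hg⟩ := this Finset.univ
    exact ⟨g, fun u v => hg u (Finset.mem_univ _) v (Finset.mem_univ _)⟩
  intro s
  induction s using Finset.induction_on with
  | empty => exact ⟨fun _ => ⟨0, lt_of_le_of_lt (Nat.zero_le _) (h v₀)⟩, by simp⟩
  | insert a s ha ih =>
    obtain ⟨g, hg⟩ := ih
    obtain ⟨c, hc⟩ : ∃ c, c ∉ g '' {u | G.Adj a u} := by
      by_contra! hall
      have h1 : g '' {u | G.Adj a u} = Set.univ := Set.eq_univ_of_forall hall
      have h2 := Set.ncard_image_le (f := g) (Set.toFinite {u | G.Adj a u})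
      rw [h1, Set.ncard_univ, Nat.card_fin] at h2
      exact absurd (h a) (by omega)
    have hc' : ∀ u, G.Adj a u → g u ≠ c := fun u hu hgu => hc ⟨u, hu, hgu⟩
    refine ⟨Function.update g a c, fun u hu v hv huv => ?_⟩
    rw [Finset.mem_insert] at hu hv
    rcases eq_or_ne u a with rfl | hua
    · rw [Function.update_self, Function.update_of_ne huv.ne']
      exact (hc' v huv).symm
    · rw [Function.update_of_ne hua]
      rcases eq_or_ne v a with rfl | hva
      · rw [Function.update_self]
        exact hc' u huv.symm
      · rw [Function.update_of_ne hva]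
        exact hg u (hu.resolve_left hua) v (hv.resolve_left hva) huv

/-- Greedy colouring of the graph joining distinct vertices with a common neighbour; its degrees are
at most `Δ ^ 2`. -/
theorem exists_distanceTwo [Finite V] (G : SimpleGraph V) (Δ : ℕ)
    (h : ∀ v, {u | G.Adj v u}.ncard ≤ Δ) : ∃ g : V → Fin (Δ ^ 2 + 1), DistanceTwo G g := by
  classical
  have := Fintype.ofFinite V
  let G2 : SimpleGraph V :=
    { Adj := fun b c => b ≠ c ∧ ∃ a, G.Adj a b ∧ G.Adj a c
      symm := ⟨fun b c ⟨hne, a, hb, hc⟩ => ⟨hne.symm, a, hc, hb⟩⟩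
      loopless := ⟨fun b hb => hb.1 rfl⟩ }
  let nb : V → Finset V := fun v => G.neighborFinset v
  obtain ⟨g, hg⟩ := exists_coloring_of_ncard_lt G2 (Δ ^ 2 + 1) fun v => by
    have hsub : {u | G2.Adj v u} ⊆
        ((nb v).biUnion nb : Finset V) := by
      rintro u ⟨-, a, hv, hu⟩
      simp only [Finset.coe_biUnion, Set.mem_iUnion, Finset.mem_coe, SimpleGraph.mem_neighborFinset, nb]
      exact ⟨a, hv.symm, hu⟩
    have hdeg : ∀ v, (nb v).card ≤ Δ := fun v => by
      refine le_trans (le_of_eq ?_) (h v)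
      rw [← Set.ncard_coe_finset]
      congr 1
      ext
      simp [nb]
    have h1 := Set.ncard_le_ncard hsub (Set.toFinite _)
    rw [Set.ncard_coe_finset] at h1
    have h2 := Finset.card_biUnion_le_card_mul (nb v) nb Δ
      fun a _ => hdeg a
    have h3 := Nat.mul_le_mul_right Δ (hdeg v)
    rw [Nat.lt_succ_iff, pow_two]
    exact h1.trans (h2.trans h3)
  refine ⟨g, fun a b c hb hc hbc => ?_⟩
  by_contra hne
  exact hg b c ⟨hne, a, hb, hc⟩ hbc

/-! ### Balanced separators in chordal graphs -/

theorem reachable_induct {G : SimpleGraph V} {P : V → Prop} {u v : V} (h : G.Reachable u v)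
    (hu : P u) (step : ∀ a b, P a → G.Adj a b → P b) : P v := by
  obtain ⟨p⟩ := h
  induction p with
  | nil => exact hu
  | cons hab _ ih => exact ih (step _ _ hu hab)

/-- Shortest paths are induced: any other edge between their vertices would be a shortcut. -/
theorem mem_edges_of_length_eq_dist {F : SimpleGraph V} {u v : V} (p : F.Walk u v)
    (hp : p.length = F.dist u v) {a b : V} (ha : a ∈ p.support) (hb : b ∈ p.support)
    (hab : F.Adj a b) : s(a, b) ∈ p.edges := by
  obtain ⟨i, rfl, hi⟩ := SimpleGraph.Walk.mem_support_iff_exists_getVert.1 ha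
  obtain ⟨j, rfl, hj⟩ := SimpleGraph.Walk.mem_support_iff_exists_getVert.1 hb
  have short : ∀ i j, i ≤ p.length → j ≤ p.length → F.Adj (p.getVert i) (p.getVert j) →
      j ≤ i + 1 := by
    intro i j hi hj hij
    have h1 := F.dist_le ((p.take i).append (SimpleGraph.Walk.cons hij (p.drop j)))
    rw [SimpleGraph.Walk.length_append, SimpleGraph.Walk.length_cons,
      SimpleGraph.Walk.take_length, SimpleGraph.Walk.drop_length] at h1
    omega
  have h1 := short i j hi hj hab
  have h2 := short j i hj hi hab.symm
  have hne : i ≠ j := by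
    rintro rfl
    exact hab.ne rfl
  rw [SimpleGraph.Walk.mk_mem_edges_iff_exists]
  rcases (show j = i + 1 ∨ i = j + 1 by omega) with rfl | rfl
  · exact ⟨i, by omega, rfl⟩
  · exact ⟨j, by omega, Sym2.eq_swap⟩

/-- In a chordal graph there is no induced cycle consisting of an edge `x y` and an induced path of
positive length. -/
theorem IsChordal.false_of_path {H F : SimpleGraph V} (hH : IsChordal H) (hF : F ≤ H) {x y u z : V}
    (q : F.Walk u z) (hq : q.IsPath) (huz : u ≠ z) (hxq : x ∉ q.support) (hyq : y ∉ q.support)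
    (hxy : H.Adj x y) (hyu : H.Adj y u) (hzx : H.Adj z x)
    (hx : ∀ a ∈ q.support, H.Adj x a → a = z) (hy : ∀ a ∈ q.support, H.Adj y a → a = u)
    (hind : ∀ a ∈ q.support, ∀ b ∈ q.support, H.Adj a b → s(a, b) ∈ q.edges) : False := by
  have hlen : 1 ≤ q.length := by
    rcases Nat.eq_zero_or_pos q.length with h | h
    · exact absurd (SimpleGraph.Walk.eq_of_length_eq_zero h) huz
    · exact h
  let q' : H.Walk u z := q.mapLe hF
  have hs : q'.support = q.support := by simp [q']
  have he : q'.edges = q.edges := by simp [q']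
  have hl : q'.length = q.length := by simp [q']
  have hq' : q'.IsPath := (SimpleGraph.Walk.isPath_mapLe hF).2 hq
  let c : H.Walk x x := .cons hxy (.cons hyu (q'.concat hzx))
  have hc : c.IsCycle := by
    rw [SimpleGraph.Walk.cons_isCycle_iff, SimpleGraph.Walk.cons_isPath_iff]
    refine ⟨⟨hq'.concat (by rwa [hs]) hzx, ?_⟩, ?_⟩
    · rw [SimpleGraph.Walk.support_concat, hs]
      simp [hyq, hxy.ne']
    · rw [SimpleGraph.Walk.edges_cons, SimpleGraph.Walk.edges_concat, List.mem_cons,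
        List.concat_eq_append, List.mem_append, List.mem_singleton, not_or, not_or]
      refine ⟨?_, fun h => hxq ?_, ?_⟩
      · rw [Sym2.eq_iff]
        rintro (⟨h, -⟩ | ⟨rfl, -⟩)
        · exact hxy.ne h
        · exact hxq q.start_mem_support
      · rw [he] at h
        exact q.fst_mem_support_of_mem_edges h
      · rw [Sym2.eq_iff]
        rintro (⟨-, h⟩ | ⟨-, rfl⟩)
        · exact hxy.ne' h
        · exact hyq q.end_mem_support
  obtain ⟨a, ha, b, hb, hab, hne⟩ := hH x c hc (by simp [c, hl]; omega)
  have hmem : ∀ a, a ∈ c.support ↔ a = x ∨ a = y ∨ a ∈ q.support := by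
    intro a
    simp only [c, SimpleGraph.Walk.support_cons, SimpleGraph.Walk.support_concat, hs,
      List.mem_cons, List.mem_append, List.not_mem_nil, or_false]
    tauto
  have hedge : ∀ e, e ∈ c.edges ↔ e = s(x, y) ∨ e = s(y, u) ∨ e ∈ q.edges ∨ e = s(z, x) := by
    intro e
    simp only [c, SimpleGraph.Walk.edges_cons, SimpleGraph.Walk.edges_concat, he,
      List.mem_cons, List.concat_eq_append, List.mem_append, List.not_mem_nil, or_false]
  rw [hmem] at ha hb
  rw [hedge] at hne
  push Not at hne
  obtain ⟨n1, n2, n3, n4⟩ := hne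
  rcases ha with rfl | rfl | ha <;> rcases hb with rfl | rfl | hb
  · exact hab.ne rfl
  · exact n1 rfl
  · exact n4 (by rw [hx b hb hab, Sym2.eq_swap])
  · exact n1 Sym2.eq_swap
  · exact hab.ne rfl
  · exact n2 (by rw [hy b hb hab])
  · exact n4 (by rw [hx a ha hab.symm])
  · exact n2 (by rw [hy a ha hab.symm, Sym2.eq_swap])
  · exact n3 (hind a ha b hb hab)

theorem walk_support_subset {H : SimpleGraph V} {B : Set V} {u v : V} (p : (within H B).Walk u v)
    (hu : u ∈ B) : ∀ a ∈ p.support, a ∈ B := by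
  induction p with
  | nil => simpa
  | cons h p ih =>
    intro a ha
    rw [SimpleGraph.Walk.support_cons, List.mem_cons] at ha
    rcases ha with rfl | ha
    · exact hu
    · exact ih h.2.2 a ha

/-- In a chordal graph, a clique each of whose vertices has a neighbour in a connected set disjoint
from it has a common neighbour in that set. -/
theorem IsChordal.exists_common_neighbor [Finite V] {H : SimpleGraph V} (hH : IsChordal H)
    {K B : Set V} (hK : H.IsClique K) (hB : B.Nonempty)
    (hconn : ∀ u ∈ B, ∀ v ∈ B, (within H B).Reachable u v) (hdisj : Disjoint K B)
    (hnb : ∀ x ∈ K, ∃ u ∈ B, H.Adj x u) : ∃ v ∈ B, ∀ x ∈ K, H.Adj x v := by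
  -- Take `v` with the most neighbours in `K`. If it misses `x`, let `z` be a neighbour of `x` in
  -- `B` closest to `v`; it will see `x` and every neighbour of `v` in `K`, contradicting
  -- maximality.
  obtain ⟨v, hvB, hmax⟩ := Set.exists_max_image B (fun v => {x | x ∈ K ∧ H.Adj x v}.ncard)
    (Set.toFinite B) hB
  refine ⟨v, hvB, ?_⟩
  by_contra! hx
  obtain ⟨x, hxK, hxv⟩ := hx
  obtain ⟨z, ⟨hzB, hxz⟩, hmin⟩ := Set.exists_min_image {z | z ∈ B ∧ H.Adj x z}
    (fun z => (within H B).dist v z) (Set.toFinite _) (hnb x hxK)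
  have hnot : ∀ {a}, a ∈ K → a ∉ B := fun h h' => Set.disjoint_left.1 hdisj h h'
  obtain ⟨p, hp⟩ := (hconn v hvB z hzB).exists_walk_length_eq_dist
  have hsub := walk_support_subset p hvB
  have hvz : ∀ i ≤ p.length, H.Adj x (p.getVert i) → i = p.length := by
    intro i hi hxi
    have h1 := hmin (p.getVert i) ⟨hsub _ (p.getVert_mem_support i), hxi⟩
    have h2 := (within H B).dist_le (p.take i)
    rw [SimpleGraph.Walk.take_length] at h2
    omega
  have hyz : ∀ y ∈ K, H.Adj y v → H.Adj y z := by
    intro y hyK hyv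
    by_contra hyz
    classical
    -- From the last neighbour of `y` on the shortest path, the remainder to `z` closes up through
    -- `x` and `y` into a chordless cycle.
    let j := Nat.findGreatest (fun i => H.Adj y (p.getVert i)) p.length
    have hj : H.Adj y (p.getVert j) :=
      Nat.findGreatest_spec (P := fun i => H.Adj y (p.getVert i)) (Nat.zero_le _)
        (by simpa using hyv)
    have hjle : j ≤ p.length := Nat.findGreatest_le _
    have hjmax : ∀ i ≤ p.length, H.Adj y (p.getVert i) → i ≤ j := fun i hi h =>
      Nat.le_findGreatest hi h
    have hqlen : (p.drop j).length = (within H B).dist (p.getVert j) z := by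
      refine le_antisymm ?_ ((within H B).dist_le _)
      obtain ⟨r, hr⟩ := (p.drop j).reachable.exists_walk_length_eq_dist
      have := (within H B).dist_le ((p.take j).append r)
      rw [SimpleGraph.Walk.length_append, SimpleGraph.Walk.take_length, ← hp, hr] at this
      rw [SimpleGraph.Walk.drop_length]
      omega
    have hqmem : ∀ a ∈ (p.drop j).support, ∃ i, j ≤ i ∧ i ≤ p.length ∧ p.getVert i = a := by
      intro a ha
      obtain ⟨i, hi, hil⟩ := SimpleGraph.Walk.mem_support_iff_exists_getVert.1 ha
      rw [SimpleGraph.Walk.drop_length] at hil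
      rw [SimpleGraph.Walk.drop_getVert] at hi
      exact ⟨_, by omega, by omega, hi⟩
    have hqB : ∀ a ∈ (p.drop j).support, a ∈ B := by
      intro a ha
      obtain ⟨i, -, -, rfl⟩ := hqmem a ha
      exact hsub _ (p.getVert_mem_support i)
    have hyx : y ≠ x := by
      rintro rfl
      exact hxv hyv
    refine hH.false_of_path (F := within H B) (fun _ _ h => h.1) (p.drop j)
      ((p.drop j).isPath_of_length_eq_dist hqlen) ?_ (fun h => hnot hxK (hqB _ h))
      (fun h => hnot hyK (hqB _ h)) (hK hxK hyK hyx.symm) hj hxz.symm ?_ ?_ ?_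
    · intro h
      exact hyz (h ▸ hj)
    · intro a ha hxa
      obtain ⟨i, -, hi, rfl⟩ := hqmem a ha
      rw [hvz i hi hxa, SimpleGraph.Walk.getVert_length]
    · intro a ha hya
      obtain ⟨i, hij, hi, rfl⟩ := hqmem a ha
      rw [le_antisymm (hjmax i hi hya) hij]
    · exact fun a ha b hb hab =>
        mem_edges_of_length_eq_dist (p.drop j) hqlen ha hb ⟨hab, hqB a ha, hqB b hb⟩
  refine absurd (hmax z hzB) (not_le.2 (Set.ncard_lt_ncard ⟨?_, ?_⟩ (Set.toFinite _)))
  · exact fun y hy => ⟨hy.1, hyz y hy.1 hy.2⟩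
  · exact fun h => hxv (h ⟨hxK, hxz⟩ : x ∈ K ∧ H.Adj x v).2

theorem within_reachable_mem {H : SimpleGraph V} {B : Set V} {u v : V}
    (h : (within H B).Reachable u v) (hu : u ∈ B) : v ∈ B :=
  reachable_induct (P := (· ∈ B)) h hu fun _ _ _ hab => hab.2.2

/-- A chordal graph without cliques on `n + 1` vertices has balanced separators of size `n`. -/
theorem IsChordal.exists_separator [Finite V] {H : SimpleGraph V} (hH : IsChordal H) {n : ℕ}
    (hfree : H.CliqueFree (n + 1)) (S : Set V) :
    ∃ X : Set V, X.ncard ≤ n ∧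
      ∀ v ∉ X, 2 * {u | u ∈ S ∧ (within H Xᶜ).Reachable v u}.ncard ≤ S.ncard := by
  by_contra! hcon
  have hcard : ∀ X : Set V, H.IsClique X → X.ncard ≤ n := by
    intro X hX
    by_contra! hn
    obtain ⟨Y, hYX, hY⟩ := Set.exists_subset_card_eq hn
    refine hfree (Set.toFinite Y).toFinset ⟨?_, ?_⟩
    · rw [Set.Finite.coe_toFinset]
      exact hX.subset hYX
    · rw [← Set.ncard_eq_toFinset_card, hY]
  have hheavy : ∀ X : Set V, H.IsClique X →
      ∃ v ∉ X, S.ncard < 2 * {u | u ∈ S ∧ (within H Xᶜ).Reachable v u}.ncard :=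
    fun X hX => hcon X (hcard X hX)
  -- Among cliques with a component holding over half of `S`, take the smallest such component.
  -- Exchanging the clique for its vertices attached to that component, plus a common neighbour
  -- inside, yields a smaller one.
  obtain ⟨⟨X, v⟩, ⟨hX, hv, hSv⟩, hmin⟩ := Set.exists_min_image
    {Y : Set V × V | H.IsClique Y.1 ∧ Y.2 ∉ Y.1 ∧
      S.ncard < 2 * {u | u ∈ S ∧ (within H Y.1ᶜ).Reachable Y.2 u}.ncard}
    (fun Y => {u | (within H Y.1ᶜ).Reachable Y.2 u}.ncard) (Set.toFinite _) (by
      have h0 : H.IsClique (∅ : Set V) := by simp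
      obtain ⟨v, hv, h⟩ := hheavy ∅ h0
      exact ⟨(∅, v), h0, hv, h⟩)
  simp only at hX hv hSv hmin
  set B : Set V := {u | (within H Xᶜ).Reachable v u} with hB
  have hvB : v ∈ B := SimpleGraph.Reachable.refl v
  have hBX : ∀ u ∈ B, u ∉ X := fun u hu => within_reachable_mem hu hv
  have hBv : ∀ u ∈ B, (within H B).Reachable v u := fun u hu =>
    (reachable_induct (P := fun a => a ∈ B ∧ (within H B).Reachable v a) hu ⟨hvB, .refl v⟩
      fun a b ha hab =>
        have hbB : b ∈ B := SimpleGraph.Reachable.trans ha.1 hab.reachable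
        have hab' : (within H B).Adj a b := ⟨hab.1, ha.1, hbB⟩
        ⟨hbB, ha.2.trans hab'.reachable⟩).2
  obtain ⟨w, hwB, hw⟩ := hH.exists_common_neighbor (K := {x | x ∈ X ∧ ∃ u ∈ B, H.Adj x u})
    (hX.subset fun x hx => hx.1) ⟨v, hvB⟩
    (fun a ha b hb => (hBv a ha).symm.trans (hBv b hb))
    (Set.disjoint_left.2 fun x hx hxB => hBX x hxB hx.1) (fun x hx => hx.2)
  set K : Set V := {x | x ∈ X ∧ ∃ u ∈ B, H.Adj x u} with hKdef
  have hX' : H.IsClique (insert w K) :=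
    SimpleGraph.isClique_insert.2 ⟨hX.subset fun x hx => hx.1, fun x hx _ => (hw x hx).symm⟩
  obtain ⟨v', hv', hSv'⟩ := hheavy _ hX'
  -- Two sets each holding over half of `S` must meet.
  obtain ⟨a, haB, hav'⟩ : ∃ a ∈ B, (within H (insert w K)ᶜ).Reachable v' a := by
    by_contra! hno
    have hd : Disjoint {u | u ∈ S ∧ (within H Xᶜ).Reachable v u}
        {u | u ∈ S ∧ (within H (insert w K)ᶜ).Reachable v' u} :=
      Set.disjoint_left.2 fun u hu hu' => hno u hu.2 hu'.2
    have h1 := Set.ncard_union_eq hd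
    have h2 : ({u | u ∈ S ∧ (within H Xᶜ).Reachable v u} ∪
        {u | u ∈ S ∧ (within H (insert w K)ᶜ).Reachable v' u}).ncard ≤ S.ncard :=
      Set.ncard_le_ncard (by rintro u (hu | hu) <;> exact hu.1) (Set.toFinite _)
    omega
  have hsub : ∀ u, (within H (insert w K)ᶜ).Reachable v' u → u ∈ B := fun u hu =>
    reachable_induct (P := (· ∈ B)) (hav'.symm.trans hu) haB fun b c hb hbc => by
      have hcX : c ∉ X := fun hc => hbc.2.2 (Or.inr ⟨hc, b, hb, hbc.1.symm⟩)
      have hadj : (within H Xᶜ).Adj b c := ⟨hbc.1, hBX b hb, hcX⟩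
      exact SimpleGraph.Reachable.trans hb hadj.reachable
  refine absurd (hmin (insert w K, v') ⟨hX', hv', hSv'⟩)
    (not_le.2 (Set.ncard_lt_ncard ⟨hsub, fun h => ?_⟩ (Set.toFinite _)))
  exact within_reachable_mem (h hwB) hv' (Set.mem_insert _ _)

/-! ### Layerings with small bags -/

theorem ncard_eq_sum_fiber [Finite V] {ι : Type*} [Fintype ι] (f : V → ι) (T : Set V) :
    T.ncard = ∑ c, {u | u ∈ T ∧ f u = c}.ncard := by
  classical
  have := Fintype.ofFinite V
  rw [Set.ncard_eq_toFinset_card', Finset.card_eq_sum_card_fiberwise (f := f) (t := Finset.univ)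
    (fun _ _ => Finset.mem_coe.2 (Finset.mem_univ _))]
  refine Finset.sum_congr rfl fun c _ => ?_
  rw [Set.ncard_eq_toFinset_card']
  congr 1
  ext
  simp

/-- With two terms at least `2 * n`, each saves `2 * n`. With one, balance makes the remainder at
least `2 * n`. With none, no maximum exceeds its `a i`, and `hx` suffices. -/
theorem sum_max_le {ι : Type*} (s : Finset ι) (a : ι → ℕ) (n x : ℕ)
    (h : ∀ i ∈ s, 2 * a i ≤ ∑ j ∈ s, a j + x) (hx : 4 * n < ∑ j ∈ s, a j + x) :
    ∑ i ∈ s, max (a i) (2 * a i - 2 * n) + 4 * n ≤ 2 * ∑ i ∈ s, a i + 2 * x := by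
  classical
  by_cases h1 : ∃ i ∈ s, 2 * n ≤ a i
  · obtain ⟨i, hi, hai⟩ := h1
    have hsi := h i hi
    rw [← Finset.add_sum_erase s a hi] at hsi hx ⊢
    rw [← Finset.add_sum_erase s _ hi]
    by_cases h2 : ∃ j ∈ s.erase i, 2 * n ≤ a j
    · obtain ⟨j, hj, haj⟩ := h2
      rw [← Finset.add_sum_erase (s.erase i) a hj, ← Finset.add_sum_erase (s.erase i) _ hj]
      have : ∑ l ∈ (s.erase i).erase j, max (a l) (2 * a l - 2 * n) ≤
          ∑ l ∈ (s.erase i).erase j, 2 * a l := Finset.sum_le_sum fun l _ => by omega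
      rw [← Finset.mul_sum] at this
      omega
    · push Not at h2
      have : ∑ l ∈ s.erase i, max (a l) (2 * a l - 2 * n) ≤ ∑ l ∈ s.erase i, a l :=
        Finset.sum_le_sum fun l hl => by
          have := h2 l hl
          omega
      omega
  · push Not at h1
    have : ∑ l ∈ s, max (a l) (2 * a l - 2 * n) ≤ ∑ l ∈ s, a l :=
      Finset.sum_le_sum fun l hl => by
        have := h1 l hl
        omega
    omega

theorem ncard_neighbors_le [Finite V] {G : SimpleGraph V} {Δ : ℕ}
    (hdeg : ∀ v, {u | G.Adj v u}.ncard ≤ Δ) (S : Set V) :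
    {u | ∃ s ∈ S, G.Adj s u}.ncard ≤ S.ncard * Δ := by
  classical
  have := Fintype.ofFinite V
  let nb : V → Finset V := fun v => {u | G.Adj v u}.toFinset
  have h1 := Finset.card_biUnion_le_card_mul S.toFinset nb Δ fun a _ => by
    rw [← Set.ncard_eq_toFinset_card']
    exact hdeg a
  rw [← Set.ncard_eq_toFinset_card'] at h1
  refine le_trans (le_of_eq ?_) h1
  rw [← Set.ncard_coe_finset]
  congr 1
  ext
  simp [nb]

/-- `d` is a layering of `G[A]` whose layer of depth zero contains `S` and has at most `r` vertices,
and all of whose bags have at most `W` vertices. -/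
structure IsLayering (G : SimpleGraph V) (A S : Set V) (r W : ℕ) (d : V → ℕ) : Prop where
  adj : ∀ u ∈ A, ∀ v ∈ A, G.Adj u v → d u ≤ d v + 1
  root : ∀ u ∈ S, d u = 0
  root_card : {u | u ∈ A ∧ d u = 0}.ncard ≤ r
  bag_card : ∀ v ∈ A, (bag G A d v).ncard ≤ W

/-- Layer zero becomes empty, so any bound `r'` holds for it; this serves an empty root set. -/
theorem IsLayering.shift [Finite V] {G : SimpleGraph V} {A S : Set V} {r W : ℕ} {d : V → ℕ}
    (h : IsLayering G A S r W d) (r' : ℕ) : IsLayering G A ∅ r' W fun v => d v + 1 where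
  adj u hu v hv huv := by
    have := h.adj u hu v hv huv
    omega
  root u hu := hu.elim
  root_card := by simp
  bag_card v hv := by
    refine le_trans (Set.ncard_le_ncard ?_ (Set.toFinite _)) (h.bag_card v hv)
    rintro u ⟨huA, hu, hr⟩
    exact ⟨huA, Nat.succ_injective hu,
      hr.mono (within_mono le_rfl fun z hz => ⟨hz.1, Nat.le_of_succ_le_succ hz.2⟩)⟩

open Classical in
/-- Putting a new layer `S` below a layering of `G[A \ S]` whose layer of depth zero contains all
neighbours of `S`. -/
theorem IsLayering.cons [Finite V] {G : SimpleGraph V} {A S N : Set V} {r r' W : ℕ} {d : V → ℕ}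
    (h : IsLayering G (A \ S) N r' W d) (hN : ∀ s ∈ S, ∀ u ∈ A \ S, G.Adj s u → u ∈ N)
    (hr : S.ncard ≤ r) (hW : S.ncard ≤ W) :
    IsLayering G A S r W fun v => if v ∈ S then 0 else d v + 1 where
  adj u hu v hv huv := by
    by_cases huS : u ∈ S
    · simp [huS]
    · by_cases hvS : v ∈ S
      · simp [huS, hvS, h.root u (hN v hvS u ⟨hu, huS⟩ huv.symm)]
      · have := h.adj u ⟨hu, huS⟩ v ⟨hv, hvS⟩ huv
        simp only [huS, hvS, if_false]
        omega
  root u hu := if_pos hu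
  root_card := by
    refine le_trans (Set.ncard_le_ncard ?_ (Set.toFinite _)) hr
    rintro u ⟨-, hu⟩
    by_contra huS
    simp [huS] at hu
  bag_card v hv := by
    by_cases hvS : v ∈ S
    · refine le_trans (Set.ncard_le_ncard ?_ (Set.toFinite _)) hW
      rintro u ⟨-, hu, -⟩
      by_contra huS
      simp [huS, hvS] at hu
    · refine le_trans (Set.ncard_le_ncard ?_ (Set.toFinite _)) (h.bag_card v ⟨hv, hvS⟩)
      rintro u ⟨huA, hu, hreach⟩
      have huS : u ∉ S := by
        intro huS
        simp [huS, hvS] at hu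
      refine ⟨⟨huA, huS⟩, by simpa [huS, hvS] using hu,
        hreach.mono (within_mono le_rfl fun z hz => ?_)⟩
      have hz2 := hz.2
      have hzS : z ∉ S := by
        intro hzS
        simp [hzS, hvS] at hz2
      simp only [hzS, hvS, if_false] at hz2
      exact ⟨⟨hz.1, hzS⟩, by omega⟩

/-- The hypothesis of balanced separators of size `n`. -/
def HasSeparators (G : SimpleGraph V) (n : ℕ) : Prop :=
  ∀ S : Set V, ∃ X : Set V, X.ncard ≤ n ∧
    ∀ v ∉ X, 2 * {u | u ∈ S ∧ (within G Xᶜ).Reachable v u}.ncard ≤ S.ncard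

open Classical in
/-- Gluing layerings of the parts into which a set `X` separates `G[A]`. -/
theorem IsLayering.glue [Finite V] {G : SimpleGraph V} {A X : Set V} {W r : ℕ}
    {S : (within G Xᶜ).ConnectedComponent → Set V}
    {rc : (within G Xᶜ).ConnectedComponent → ℕ}
    {d : (within G Xᶜ).ConnectedComponent → V → ℕ}
    (h : ∀ c, IsLayering G
      {u | u ∈ A ∧ (u ∈ X ∨ (within G Xᶜ).connectedComponentMk u = c)} (S c) (rc c) W (d c))
    (hX : ∀ c, X ∩ A ⊆ S c) {T : Set V}
    (hT : ∀ u ∈ T, u ∉ X → u ∈ S ((within G Xᶜ).connectedComponentMk u))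
    (hr : {u | u ∈ A ∧ (if u ∈ X then 0 else
      d ((within G Xᶜ).connectedComponentMk u) u) = 0}.ncard ≤ r) (hrW : r ≤ W) :
    IsLayering G A T r W
      fun v => if v ∈ X then 0 else d ((within G Xᶜ).connectedComponentMk v) v where
  adj u hu v hv huv := by
    by_cases huX : u ∈ X
    · simp [huX]
    · by_cases hvX : v ∈ X
      · have h1 := (h ((within G Xᶜ).connectedComponentMk u)).adj u ⟨hu, Or.inr rfl⟩ v
          ⟨hv, Or.inl hvX⟩ huv
        rw [(h _).root v (hX _ ⟨hvX, hv⟩)] at h1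
        simpa [huX, hvX] using h1
      · have hadj : (within G Xᶜ).Adj u v := ⟨huv, huX, hvX⟩
        have hc := SimpleGraph.ConnectedComponent.connectedComponentMk_eq_of_adj hadj
        have h1 := (h ((within G Xᶜ).connectedComponentMk v)).adj u ⟨hu, Or.inr hc⟩ v
          ⟨hv, Or.inr rfl⟩ huv
        simpa [huX, hvX, hc] using h1
  root u hu := by
    by_cases huX : u ∈ X
    · exact if_pos huX
    · simp only [huX, if_false]
      exact (h _).root u (hT u hu huX)
  root_card := hr
  bag_card v hv := by
    -- A bag of depth zero lies in the root layer. At positive depth the region avoids `X`, which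
    -- has depth zero, so the bag stays in one part.
    by_cases hd : (if v ∈ X then 0 else d ((within G Xᶜ).connectedComponentMk v) v) = 0
    · refine le_trans (Set.ncard_le_ncard ?_ (Set.toFinite _)) (hr.trans hrW)
      rintro u ⟨huA, hu, -⟩
      exact ⟨huA, hu.trans hd⟩
    · have hvX : v ∉ X := fun hvX => hd (if_pos hvX)
      refine le_trans (Set.ncard_le_ncard ?_ (Set.toFinite _))
        ((h ((within G Xᶜ).connectedComponentMk v)).bag_card v ⟨hv, Or.inr rfl⟩)
      rintro u ⟨huA, hu, hreach⟩
      set c := (within G Xᶜ).connectedComponentMk v with hc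
      simp only [hvX, if_false] at hu hreach hd
      rw [← hc] at hu hreach
      have key := reachable_induct (P := fun a => a ∉ X ∧ (within G Xᶜ).connectedComponentMk a = c ∧
          a ∈ A ∧ d c v ≤ d c a ∧ (within G {z | z ∈ {u | u ∈ A ∧ (u ∈ X ∨
          (within G Xᶜ).connectedComponentMk u = c)} ∧ d c v ≤ d c z}).Reachable v a) hreach
        ⟨hvX, rfl, hv, le_rfl, .refl v⟩ (by
          rintro a b ⟨haX, hac, haA, had, har⟩ ⟨hab, -, hbA, hbd⟩
          have hbX : b ∉ X := by
            intro hbX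
            simp only [hbX, if_true] at hbd
            omega
          have hadj : (within G Xᶜ).Adj a b := ⟨hab, haX, hbX⟩
          have hbc : (within G Xᶜ).connectedComponentMk b = c :=
            (SimpleGraph.ConnectedComponent.connectedComponentMk_eq_of_adj hadj).symm.trans hac
          simp only [hbX, if_false] at hbd
          rw [hbc] at hbd
          refine ⟨hbX, hbc, hbA, hbd, har.trans (SimpleGraph.Adj.reachable ?_)⟩
          exact ⟨hab, ⟨⟨haA, Or.inr hac⟩, had⟩, ⟨hbA, Or.inr hbc⟩, hbd⟩)
      obtain ⟨huX, huc, -, -, hur⟩ := key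
      simp only [huX, if_false] at hu
      rw [huc] at hu
      exact ⟨⟨huA, Or.inr huc⟩, hu, hur⟩

/-- Every graph with balanced separators of size `n` and maximum degree at most `Δ` has a layering
with bags of size at most `8 * n * Δ - 3 * n`. -/
theorem exists_isLayering [Finite V] {G : SimpleGraph V} {n Δ : ℕ} (hn : 1 ≤ n) (hΔ : 1 ≤ Δ)
    (hsep : HasSeparators G n) (hdeg : ∀ v, {u | G.Adj v u}.ncard ≤ Δ) (m : ℕ) :
    ∀ A S : Set V, S ⊆ A → A.ncard + (A \ S).ncard = m → S.ncard ≤ 4 * (n * Δ) →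
      ∃ d, IsLayering G A S (max S.ncard (2 * S.ncard - 3 * n)) (8 * (n * Δ) - 3 * n) d := by
  classical
  have hnΔ : n ≤ n * Δ := Nat.le_mul_of_pos_right n hΔ
  induction m using Nat.strong_induction_on with
  | _ m ih =>
  intro A S hSA hm hS
  rcases S.eq_empty_or_nonempty with rfl | hSne
  · rcases A.eq_empty_or_nonempty with rfl | ⟨v, hv⟩
    · exact ⟨fun _ => 0, ⟨by simp, by simp, by simp, by simp⟩⟩
    · have h1 : (A \ {v}).ncard < A.ncard := Set.ncard_lt_ncard
        ⟨Set.sdiff_subset, fun h => (h hv).2 rfl⟩ (Set.toFinite _)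
      obtain ⟨d, hd⟩ := ih _ (by rw [← hm, Set.sdiff_empty]; exact Nat.add_lt_add_left h1 _) A {v}
        (by simpa using hv) rfl (by rw [Set.ncard_singleton]; omega)
      exact ⟨_, hd.shift _⟩
  -- Up to `4 * n` roots have at most `4 * (n * Δ)` neighbours, an admissible next root set; a
  -- larger root set is first split by a separator.
  rcases Nat.lt_or_ge (4 * n) S.ncard with hbig | hsmall
  · obtain ⟨X, hXn, hX⟩ := hsep S
    let comp := (within G Xᶜ).connectedComponentMk
    let part := fun c => {u | u ∈ A ∧ (u ∈ X ∨ comp u = c)}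
    let rest := fun c => {u | u ∈ S \ X ∧ comp u = c}
    let Sc := fun c => (X ∩ A) ∪ rest c
    have := Fintype.ofFinite (within G Xᶜ).ConnectedComponent
    have hXA : (X ∩ A).ncard ≤ n :=
      (Set.ncard_le_ncard Set.inter_subset_left (Set.toFinite _)).trans hXn
    have hrest : ∀ c, 2 * (rest c).ncard ≤ S.ncard := by
      intro c
      rcases (rest c).eq_empty_or_nonempty with h | ⟨v, hv⟩
      · simp [h]
      · refine le_trans (Nat.mul_le_mul_left 2 (Set.ncard_le_ncard ?_ (Set.toFinite _)))
          (hX v hv.1.2)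
        exact fun u hu => ⟨hu.1.1, SimpleGraph.ConnectedComponent.exact (hv.2.trans hu.2.symm)⟩
    have hSc : ∀ c, (Sc c).ncard = (X ∩ A).ncard + (rest c).ncard := fun c =>
      Set.ncard_union_eq (Set.disjoint_left.2 fun u hu hu' => hu'.1.2 hu.1)
    have hScpart : ∀ c, Sc c ⊆ part c := by
      rintro c u (hu | hu)
      · exact ⟨hu.2, Or.inl hu.1⟩
      · exact ⟨hSA hu.1.1, Or.inr hu.2⟩
    have hlt : ∀ c, (part c).ncard + (part c \ Sc c).ncard < m := by
      intro c
      -- A part equal to `A` would contain all of `S`, although it has at most `n + |S| / 2` roots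
      -- and `|S| > 4 * n`.
      have h1 : (part c).ncard < A.ncard := by
        refine Set.ncard_lt_ncard ⟨fun u hu => hu.1, fun hA => ?_⟩ (Set.toFinite _)
        have h2 : S ⊆ Sc c := by
          intro u hu
          by_cases huX : u ∈ X
          · exact Or.inl ⟨huX, hSA hu⟩
          · exact Or.inr ⟨⟨hu, huX⟩, (hA (hSA hu)).2.resolve_left huX⟩
        have h3 := Set.ncard_le_ncard h2 (Set.toFinite _)
        have h4 := hrest c
        rw [hSc] at h3
        omega
      have h2 : (part c \ Sc c).ncard ≤ (A \ S).ncard := by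
        refine Set.ncard_le_ncard ?_ (Set.toFinite _)
        rintro u ⟨⟨huA, hu⟩, hn⟩
        refine ⟨huA, fun huS => hn ?_⟩
        by_cases huX : u ∈ X
        · exact Or.inl ⟨huX, huA⟩
        · exact Or.inr ⟨⟨huS, huX⟩, hu.resolve_left huX⟩
      omega
    have hex := fun c => ih _ (hlt c) (part c) (Sc c) (hScpart c) rfl (by
      have := hrest c
      rw [hSc]
      omega)
    choose d hd using hex
    let R := {u | u ∈ A ∧ (if u ∈ X then 0 else d (comp u) u) = 0}
    -- Remove the `|X ∩ A| ≤ n` common roots from the inductive bound on the root layer of the part.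
    have hfib : ∀ c, {u | u ∈ R \ X ∧ comp u = c}.ncard ≤
        max (rest c).ncard (2 * (rest c).ncard - 2 * n) := by
      intro c
      have h1 := (hd c).root_card
      have h2 : (X ∩ A) ∪ {u | u ∈ R \ X ∧ comp u = c} ⊆ {u | u ∈ part c ∧ d c u = 0} := by
        rintro u (hu | ⟨⟨⟨huA, hu⟩, huX⟩, huc⟩)
        · exact ⟨⟨hu.2, Or.inl hu.1⟩, (hd c).root u (Or.inl hu)⟩
        · rw [if_neg huX, huc] at hu
          exact ⟨⟨huA, Or.inr huc⟩, hu⟩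
      have h3 := Set.ncard_le_ncard h2 (Set.toFinite _)
      rw [Set.ncard_union_eq (Set.disjoint_left.2 fun u hu hu' => hu'.1.2 hu.1)] at h3
      rw [hSc] at h1
      omega
    -- The vertices outside `X` number at most `2 * |S| - 4 * n` by `sum_max_le`; `X` adds at most
    -- `n`.
    have hRcard : R.ncard ≤ 2 * S.ncard - 3 * n := by
      have h1 := ncard_eq_sum_fiber comp (R \ X)
      have h2 := ncard_eq_sum_fiber comp (S \ X)
      have h3 := Set.ncard_inter_add_ncard_sdiff_eq_ncard S X
      have h4 := Set.ncard_inter_add_ncard_sdiff_eq_ncard R X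
      have h5 : (R ∩ X).ncard ≤ n :=
        (Set.ncard_le_ncard Set.inter_subset_right (Set.toFinite _)).trans hXn
      have h6 : ∑ c, {u | u ∈ R \ X ∧ comp u = c}.ncard ≤
          ∑ c, max (rest c).ncard (2 * (rest c).ncard - 2 * n) :=
        Finset.sum_le_sum fun c _ => hfib c
      have h7 := sum_max_le Finset.univ (fun c => (rest c).ncard) n (S ∩ X).ncard
        (fun c _ => by rw [← h2, add_comm, h3]; exact hrest c) (by rw [← h2, add_comm, h3]; exact hbig)
      rw [← h2] at h7
      omega
    refine ⟨_, IsLayering.glue hd (fun c => Set.subset_union_left)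
      (fun u hu huX => Or.inr ⟨⟨hu, huX⟩, rfl⟩) ?_ ?_⟩
    · exact hRcard.trans (le_max_right _ _)
    · omega
  · have hlt : (A \ S).ncard < A.ncard := Set.ncard_lt_ncard
      ⟨Set.sdiff_subset, fun h => hSne.elim fun v hv => (h (hSA hv)).2 hv⟩ (Set.toFinite _)
    let N := {u | u ∈ A \ S ∧ ∃ s ∈ S, G.Adj s u}
    have hN : N.ncard ≤ 4 * (n * Δ) := by
      have h1 := ncard_neighbors_le hdeg S
      have h2 := Nat.mul_le_mul_right Δ hsmall
      have h3 : N.ncard ≤ {u | ∃ s ∈ S, G.Adj s u}.ncard :=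
        Set.ncard_le_ncard (fun u hu => hu.2) (Set.toFinite _)
      rw [mul_assoc] at h2
      omega
    have hNle : ((A \ S) \ N).ncard ≤ (A \ S).ncard :=
      Set.ncard_le_ncard Set.sdiff_subset (Set.toFinite _)
    obtain ⟨d, hd⟩ := ih _ (by omega) (A \ S) N (fun u hu => hu.1) rfl hN
    exact ⟨_, hd.cons (fun s hs u hu hsu => ⟨hu, s, hs, hsu⟩) (le_max_left _ _) (by omega)⟩

/-! ### Assembling the bounds -/

/-- The relation of lying in the same bag of a depth function. -/
def bagSetoid (G : SimpleGraph V) (d : V → ℕ) : Setoid V where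
  r v u := u ∈ bag G Set.univ d v
  iseqv :=
    { refl := fun v => ⟨trivial, rfl, .refl v⟩
      symm := fun ⟨_, h, hr⟩ => ⟨trivial, h.symm, h ▸ hr.symm⟩
      trans := fun ⟨_, h, hr⟩ ⟨_, h', hr'⟩ =>
        ⟨trivial, h'.trans h, hr.trans (h ▸ hr')⟩ }

theorem exists_strollNonrepetitive [Finite V] {G : SimpleGraph V} {n Δ : ℕ} (hn : 1 ≤ n)
    (hΔ : 1 ≤ Δ) (hsep : HasSeparators G n) (hdeg : ∀ v, {u | G.Adj v u}.ncard ≤ Δ) :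
    ∃ f : V → Fin 4 × Fin (8 * (n * Δ) - 3 * n), StrollNonrepetitive G f := by
  obtain ⟨d, hd⟩ := exists_isLayering hn hΔ hsep hdeg _ Set.univ ∅ (Set.empty_subset _) rfl
    (by simp)
  obtain ⟨idx, hidx⟩ := exists_index (bagSetoid G d) _ fun v => hd.bag_card v trivial
  exact ⟨_, strollNonrepetitive_of_depth (fun u v => hd.adj u trivial v trivial)
    fun u v huv => hidx u v huv⟩

theorem hasSeparators_treewidth [Finite V] (G : SimpleGraph V) :
    HasSeparators G (treewidth G + 1) := by
  obtain ⟨H, hGH, hH, hfree⟩ := treewidth_spec G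
  intro S
  obtain ⟨X, hX, hS⟩ := hH.exists_separator hfree S
  refine ⟨X, hX, fun v hv => le_trans (Nat.mul_le_mul_left 2 ?_) (hS v hv)⟩
  exact Set.ncard_le_ncard (fun u hu => ⟨hu.1, hu.2.mono (within_mono hGH subset_rfl)⟩)
    (Set.toFinite _)

theorem one_le_treewidth [Finite V] {G : SimpleGraph V} {a b : V} (h : G.Adj a b) :
    1 ≤ treewidth G := by
  classical
  obtain ⟨H, hGH, -, hfree⟩ := treewidth_spec G
  by_contra! h0
  rw [Nat.lt_one_iff.1 h0] at hfree
  refine hfree {a, b} ⟨?_, Finset.card_pair h.ne⟩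
  simpa [SimpleGraph.isClique_insert] using fun _ => hGH h

theorem pathNumber_le {G : SimpleGraph V} [Finite C] {f : V → C} (hf : PathNonrepetitive G f) :
    pathNumber G ≤ Nat.card C :=
  Nat.sInf_le ⟨Finite.equivFin C ∘ f, fun t w ht hw hr =>
    hf t w ht hw fun i hi => (Finite.equivFin C).injective (hr i hi)⟩

theorem walkNumber_le {G : SimpleGraph V} [Finite C] {f : V → C} (hf : WalkNonrepetitive G f) :
    walkNumber G ≤ Nat.card C :=
  Nat.sInf_le ⟨Finite.equivFin C ∘ f, fun t w hw hr =>
    hf t w hw fun i hi => (Finite.equivFin C).injective (hr i hi)⟩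

theorem pathNumber_walkNumber_le [Fintype V] (G : SimpleGraph V) [DecidableRel G.Adj]
    (hΔ : 1 ≤ G.maxDegree) :
    (pathNumber G : ℝ) ≤ 10 * ((treewidth G : ℝ) + 1) * (7 / 2 * (G.maxDegree : ℝ) - 1) ∧
    (walkNumber G : ℝ) ≤ 10 * ((treewidth G : ℝ) + 1) * (7 / 2 * (G.maxDegree : ℝ) - 1) *
      ((G.maxDegree : ℝ) ^ 2 + 1) := by
  set Δ := G.maxDegree
  set n := treewidth G + 1 with hn
  have hdeg : ∀ v, {u | G.Adj v u}.ncard ≤ Δ := fun v => by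
    have h := G.degree_le_maxDegree v
    rw [← SimpleGraph.card_neighborFinset_eq_degree, ← Set.ncard_coe_finset,
      SimpleGraph.coe_neighborFinset] at h
    exact h
  obtain ⟨f, hf⟩ := exists_strollNonrepetitive (by omega) hΔ (hasSeparators_treewidth G) hdeg
  obtain ⟨g, hg⟩ := exists_distanceTwo G Δ hdeg
  have hp := pathNumber_le hf.pathNonrepetitive
  have hw := walkNumber_le (hf.walkNonrepetitive hg)
  rw [← hn] at hp hw
  simp only [Nat.card_prod, Nat.card_fin] at hp hw
  have hnΔ : n ≤ n * Δ := Nat.le_mul_of_pos_right n hΔ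
  have hW : ((4 * (8 * (n * Δ) - 3 * n) : ℕ) : ℝ) ≤
      10 * ((treewidth G : ℝ) + 1) * (7 / 2 * (Δ : ℝ) - 1) := by
    have h1 : 4 * (8 * (n * Δ) - 3 * n) + 10 * n ≤ 35 * (n * Δ) := by omega
    have h2 : ((4 * (8 * (n * Δ) - 3 * n) : ℕ) : ℝ) + 10 * n ≤ 35 * (n * Δ) := by exact_mod_cast h1
    have h3 : (n : ℝ) = (treewidth G : ℝ) + 1 := by rw [hn]; push_cast; rfl
    rw [← h3]
    linarith
  have hp' : (pathNumber G : ℝ) ≤ ((4 * (8 * (n * Δ) - 3 * n) : ℕ) : ℝ) := by exact_mod_cast hp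
  have hw' : (walkNumber G : ℝ) ≤ ((4 * (8 * (n * Δ) - 3 * n) : ℕ) : ℝ) * ((Δ : ℝ) ^ 2 + 1) := by
    exact_mod_cast hw
  exact ⟨hp'.trans hW, hw'.trans (mul_le_mul_of_nonneg_right hW (by positivity))⟩

end NonRep

theorem mainTheorem3 :
    (∀ (V : Type*) [Fintype V] (G : SimpleGraph V) [DecidableRel G.Adj] (k Δ : ℕ),
      NonRep.treewidth G = k → G.maxDegree = Δ → 1 ≤ Δ →
        (NonRep.pathNumber G : ℝ) ≤ 10 * ((k : ℝ) + 1) * (7 / 2 * (Δ : ℝ) - 1) ∧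
        (NonRep.walkNumber G : ℝ) ≤
          10 * ((k : ℝ) + 1) * (7 / 2 * (Δ : ℝ) - 1) * ((Δ : ℝ) ^ 2 + 1)) ∧
    (∃ c : ℝ, ∀ (V : Type*) [Fintype V] (G : SimpleGraph V) [DecidableRel G.Adj] (k Δ : ℕ),
      NonRep.treewidth G = k → G.maxDegree = Δ → 1 ≤ Δ →
        (NonRep.pathNumber G : ℝ) ≤ c * k * Δ ∧
        (NonRep.walkNumber G : ℝ) ≤ c * k * (Δ : ℝ) ^ 3) := by
  -- An edge forces k ≥ 1, so k + 1 ≤ 2k and the path bound is at most 70kΔ; Δ² + 1 ≤ 2Δ² doubles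
  -- the constant for walks.
  refine ⟨?_, 140, ?_⟩
  · rintro V _ G _ k Δ rfl rfl hΔ
    exact NonRep.pathNumber_walkNumber_le G hΔ
  · rintro V _ G _ k Δ rfl hG hΔ
    obtain ⟨hp, hw⟩ := NonRep.pathNumber_walkNumber_le G (hG ▸ hΔ)
    rw [hG] at hp hw
    have hk : 1 ≤ NonRep.treewidth G := by
      by_contra h0
      have hbot : ∀ a b, ¬ G.Adj a b := fun a b hab => h0 (NonRep.one_le_treewidth hab)
      have : G.maxDegree ≤ 0 := G.maxDegree_le_of_forall_degree_le 0 fun v => by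
        rw [← SimpleGraph.card_neighborFinset_eq_degree, Nat.le_zero, Finset.card_eq_zero,
          Finset.eq_empty_iff_forall_notMem]
        intro u hu
        exact hbot v u (by simpa using hu)
      omega
    have hk' : (1 : ℝ) ≤ NonRep.treewidth G := by exact_mod_cast hk
    have hΔ' : (1 : ℝ) ≤ Δ := by exact_mod_cast hΔ
    set k : ℝ := (NonRep.treewidth G : ℝ)
    set D : ℝ := (Δ : ℝ)
    have h70 : 10 * (k + 1) * (7 / 2 * D - 1) ≤ 70 * k * D :=
      calc 10 * (k + 1) * (7 / 2 * D - 1) ≤ 10 * (2 * k) * (7 / 2 * D) := by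
            gcongr <;> linarith
        _ = 70 * k * D := by ring
    constructor
    · have : 0 ≤ k * D := by positivity
      linarith
    · calc _ ≤ 70 * k * D * (D ^ 2 + 1) := hw.trans (by gcongr)
        _ ≤ 70 * k * D * (2 * D ^ 2) := by
          gcongr
          nlinarith
        _ = 140 * k * D ^ 3 := by ring
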